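/- **Setting.** Let $(\mathbf M,\rho)$ be a nonempty compact metric space on which a group $G$ acts by isometries, 2-point-homogeneously: if $\rho(x,y)=\rho(x',y')$, then some $g\in G$ has $g(x)=x'$, $g(y)=y'$. Let $\mu$ be the $G$-invariant Borel probability measure on $\mathbf M$. Let $\tau(x,y)=F(\rho(x,y))$ for a function $F:\mathbb R\to\mathbb R$. Let $L^2(\mathbf M,\mu)$ be the closure of the sum of mutually orthogonal, finite-dimensional, $G$-irreducible spaces $V_k$ of continuous complex functions, indexed by the integers $0\le k\le N$ with $N\in\{0,1,2,\dots\}\cup\{\infty\}$ ($N$ is finite exactly when $\mathbf M$ is finite). Let $\Phi_k$ be the zonal spherical function of $V_k$: for every $x\in\mathbf M$ the function $y\mapsto\Phi_k(\tau(x,y))$ belongs to $V_k$, and $\Phi_k(\tau(x,x))=1$. Assume that, for every $k\le N$, $\Phi_k(t)=\sum_{d=0}^k p_{kd}t^d$ is a real polynomial of degree $k$. Let $T=\{\tau(x,y):x,y\in\mathbf M\}$ and $S=T\cap[a,b]$. A finite set $C\subset\mathbf M$ is an $S$-code if $\tau(x,y)\in S$ for all distinct $x,y\in C$; $A(\mathbf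 M,S)\in\{0,1,2,\dots\}\cup\{\infty\}$ is the supremum of $|C|$ over all $S$-codes $C$. **The SDPA problem.** Let $\ell\ge1$, $a=u_1<u_2<\dots<u_{\ell+1}=b$ and $m\ge1$. For an $S$-code $C$ let $x_i^{(k)}(C)=\sum\tau(x,y)^k$, the sum over the ordered pairs of distinct $x,y\in C$ with $\tau(x,y)\in[u_i,u_{i+1})$ if $i<\ell$, and with $\tau(x,y)\in[u_\ell,b]$ if $i=\ell$. Let $Ad$ be a set (possibly empty) of positive semidefinite constraints $$A_0+cA_1+\sum_{i=1}^{\ell}\sum_{k=0}^{2m-1}x_i^{(k)}B_{i,k}\succeq0$$ with real symmetric matrices (of any size, depending on the constraint), each of which is satisfied by $c=|C|$, $x_i^{(k)}=x_i^{(k)}(C)$ for every nonempty $S$-code $C$. The SDPA problem is to maximize $c$ over real numbers $c$ and $x_i^{(k)}$ ($1\le i\le\ell$, $0\le k\le 2m-1$) subject to - (5) $\begin{pmatrix}1&c\\c&z\end{pmatrix}\succeq0$, where $z=c+x_1^{(0)}+\dots+x_\ell^{(0)}$; - (6) $c+\sum_{d=0}^kp_{kd}\sum_{i=1}^\ell x_i^{(d)}\ge0$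 for all $1\le k\le 2m-1$ with $k\le N$; - (7) $H_m(x_i^{(0)},\dots,x_i^{(2m-1)},[u_i,u_{i+1}])\succeq0$ for $i=1,\dots,\ell$, where $H_m(s_0,\dots,s_{2m-1},[\alpha,\beta])$ is the block-diagonal matrix with the $m\times m$ blocks $(s_{i+j})$, $(s_{i+j+1}-\alpha s_{i+j})$ and $(\beta s_{i+j}-s_{i+j+1})$, $0\le i,j\le m-1$; - (8) all constraints in $Ad$. Let $c^*(m)\in[-\infty,\infty]$ be the optimal value of this problem, i.e. the supremum of $c$ over all feasible points. **Theorem 6.1.** For every natural number $m\ge1$ and all data as above, $A(\mathbf M,S)\le c^*(m)$. -/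

import Mathlib

open MeasureTheory Polynomial
open scoped Matrix ENNReal

namespace CodeBound

/-! ## Two-point-homogeneous spaces and zonal spherical functions -/

/-- The group `G` acts on the metric space `M` by isometries, and any two pairs of points at equal
distance are related by an element of `G`. -/
structure IsTwoPointHomogeneous (G M : Type*) [MetricSpace M] [Group G] [MulAction G M] : Prop where
  dist_smul : ∀ (g : G) (x y : M), dist (g • x) (g • y) = dist x y
  exists_smul : ∀ x y x' y' : M, dist x y = dist x' y' → ∃ g : G, g • x = x' ∧ g • y = y'

/-- The space `W` of continuous functions is stable under all translations `f ↦ f (g • ·)`. -/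
def IsInvariant (G : Type*) {M : Type*} [MetricSpace M] [Group G] [MulAction G M]
    (W : Submodule ℂ C(M, ℂ)) : Prop :=
  ∀ g : G, ∀ f ∈ W, ∃ f' ∈ W, ∀ x : M, f' x = f (g • x)

/-- `W` is an irreducible representation of `G` (by translation of functions). -/
def IsIrreducible (G : Type*) {M : Type*} [MetricSpace M] [Group G] [MulAction G M]
    (W : Submodule ℂ C(M, ℂ)) : Prop :=
  IsInvariant G W ∧ W ≠ ⊥ ∧ ∀ U : Submodule ℂ C(M, ℂ), U ≤ W → IsInvariant G U → U = ⊥ ∨ U = W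

/-- `V 0, V 1, …` (all `V k` with `k ≤ N`, where `N` may be infinite) is a decomposition of
`L²(M, μ)` into mutually orthogonal finite-dimensional irreducible representations of `G`,
consisting of continuous functions. The `V k` with `k > N` play no role. -/
structure IsHarmonicDecomposition (G : Type*) {M : Type*} [MetricSpace M] [CompactSpace M]
    [MeasurableSpace M] [BorelSpace M] [Group G] [MulAction G M]
    (μ : Measure M) [IsFiniteMeasure μ] (N : ℕ∞) (V : ℕ → Submodule ℂ C(M, ℂ)) : Prop where
  finiteDimensional : ∀ k : ℕ, (k : ℕ∞) ≤ N → FiniteDimensional ℂ (V k)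
  irreducible : ∀ k : ℕ, (k : ℕ∞) ≤ N → IsIrreducible G (V k)
  orthogonal : ∀ j k : ℕ, (j : ℕ∞) ≤ N → (k : ℕ∞) ≤ N → j ≠ k →
    ∀ f ∈ V j, ∀ h ∈ V k, ∫ x, (starRingEnd ℂ) (f x) * h x ∂μ = 0
  dense : ((⨆ (k : ℕ) (_ : (k : ℕ∞) ≤ N), V k).map
    (ContinuousMap.toLp (E := ℂ) 2 μ ℂ).toLinearMap).topologicalClosure = ⊤

/-- The parameter `τ(x, y) = F(ρ(x, y))`, a function of the distance. -/
def tau {M : Type*} [MetricSpace M] (F : ℝ → ℝ) (x y : M) : ℝ := F (dist x y)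

/-- The polynomial `φ`, as a function of `τ`, is the zonal spherical function of the
representation `W`: for every base point `x`, the function `y ↦ φ(τ(x, y))` (which is invariant
under the stabilizer of `x`) belongs to `W`, and it takes the value `1` at the base point. -/
structure IsZonalSpherical {M : Type*} [MetricSpace M] (F : ℝ → ℝ)
    (W : Submodule ℂ C(M, ℂ)) (φ : ℝ[X]) : Prop where
  mem : ∀ x : M, ∃ f ∈ W, ∀ y : M, f y = ((φ.eval (tau F x y) : ℝ) : ℂ)
  normalized : ∀ x : M, φ.eval (tau F x x) = 1

/-! ## Codes -/

/-- The set `T` of all values of `τ`. -/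
def tauRange (M : Type*) [MetricSpace M] (F : ℝ → ℝ) : Set ℝ :=
  {t | ∃ x y : M, tau F x y = t}

/-- A finite set `C` is an `S`-code if `τ(x, y) ∈ S` for all distinct `x, y ∈ C`. -/
def IsCode {M : Type*} [MetricSpace M] (F : ℝ → ℝ) (S : Set ℝ) (C : Finset M) : Prop :=
  ∀ x ∈ C, ∀ y ∈ C, x ≠ y → tau F x y ∈ S

/-- `A(M, S)`, the supremum (possibly infinite) of the cardinalities of `S`-codes. -/
noncomputable def maxCodeSize (M : Type*) [MetricSpace M] (F : ℝ → ℝ) (S : Set ℝ) : ℕ∞ :=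
  ⨆ (C : Finset M) (_ : IsCode F S C), (C.card : ℕ∞)

/-- The `i`-th part of the partition of `[u 0, u ℓ]` by the points `u 0 < ⋯ < u ℓ`:
half-open intervals, except the last one, which is closed. -/
def piece {ℓ : ℕ} (u : Fin (ℓ + 1) → ℝ) (i : Fin ℓ) : Set ℝ :=
  if (i : ℕ) + 1 = ℓ then Set.Icc (u i.castSucc) (u i.succ)
  else Set.Ico (u i.castSucc) (u i.succ)

open Classical in
/-- The sum of `τ(x, y) ^ d` over the ordered pairs of distinct points of `C` whose `τ` lies in
the `i`-th part of the partition `u`. -/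
noncomputable def powerSum {M : Type*} [MetricSpace M] (F : ℝ → ℝ) {ℓ : ℕ} (u : Fin (ℓ + 1) → ℝ)
    (C : Finset M) (i : Fin ℓ) (d : ℕ) : ℝ :=
  ∑ p ∈ C.offDiag with tau F p.1 p.2 ∈ piece u i, tau F p.1 p.2 ^ d

/-! ## The semidefinite program -/

/-- The Hankel matrix `R_m = (s_{i+j})`. -/
def hankelR {m : ℕ} (s : Fin (2 * m) → ℝ) : Matrix (Fin m) (Fin m) ℝ :=
  Matrix.of fun i j => s ⟨i + j, by omega⟩

/-- The matrix `F_m^+(a) = (s_{i+j+1} - a s_{i+j})`. -/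
def hankelPlus {m : ℕ} (s : Fin (2 * m) → ℝ) (a : ℝ) : Matrix (Fin m) (Fin m) ℝ :=
  Matrix.of fun i j => s ⟨i + j + 1, by omega⟩ - a * s ⟨i + j, by omega⟩

/-- The matrix `F_m^-(b) = (b s_{i+j} - s_{i+j+1})`. -/
def hankelMinus {m : ℕ} (s : Fin (2 * m) → ℝ) (b : ℝ) : Matrix (Fin m) (Fin m) ℝ :=
  Matrix.of fun i j => b * s ⟨i + j, by omega⟩ - s ⟨i + j + 1, by omega⟩

/-- The block-diagonal matrix `H_m(s_0, …, s_{2m-1}, [a, b])`. -/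
def hankelH {m : ℕ} (s : Fin (2 * m) → ℝ) (a b : ℝ) :
    Matrix (Fin m ⊕ (Fin m ⊕ Fin m)) (Fin m ⊕ (Fin m ⊕ Fin m)) ℝ :=
  Matrix.fromBlocks (hankelR s) 0 0 (Matrix.fromBlocks (hankelPlus s a) 0 0 (hankelMinus s b))

/-- A positive semidefinite constraint (linear matrix inequality) in the variables `c` and
`x i d`, `i < ℓ`, `d < 2m`: symmetric real matrices `A₀`, `A₁`, `B i d` of some size. -/
structure PsdConstraint (ℓ m : ℕ) where
  size : ℕ
  A₀ : Matrix (Fin size) (Fin size) ℝ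
  A₁ : Matrix (Fin size) (Fin size) ℝ
  B : Fin ℓ → Fin (2 * m) → Matrix (Fin size) (Fin size) ℝ
  A₀_symm : A₀.IsSymm
  A₁_symm : A₁.IsSymm
  B_symm : ∀ i d, (B i d).IsSymm

/-- The constraint `A₀ + c A₁ + ∑ x i d • B i d ⪰ 0` holds at `(c, x)`. -/
def PsdConstraint.Holds {ℓ m : ℕ} (L : PsdConstraint ℓ m) (c : ℝ)
    (x : Fin ℓ → Fin (2 * m) → ℝ) : Prop :=
  (L.A₀ + c • L.A₁ + ∑ i, ∑ d, x i d • L.B i d).PosSemidef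

/-- `(c, x)` is feasible for the program with polynomials `Φ k`, `k ≤ N`, partition `u`,
order `m ≥ 1` and additional constraints `Ad`. -/
structure IsFeasible (N : ℕ∞) (Φ : ℕ → ℝ[X]) {ℓ : ℕ} (u : Fin (ℓ + 1) → ℝ) (m : ℕ) (hm : 0 < m)
    (Ad : Set (PsdConstraint ℓ m)) (c : ℝ) (x : Fin ℓ → Fin (2 * m) → ℝ) : Prop where
  /-- `[[1, c], [c, z]] ⪰ 0`, with `z = c + x₁⁽⁰⁾ + ⋯ + x_ℓ⁽⁰⁾`. -/
  gamma : (!![1, c; c, c + ∑ i, x i ⟨0, by omega⟩] : Matrix (Fin 2) (Fin 2) ℝ).PosSemidef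
  /-- The Delsarte constraints, for the existing `k` among `1, …, 2m - 1`. -/
  delsarte : ∀ k : ℕ, 1 ≤ k → ∀ hk : k < 2 * m, (k : ℕ∞) ≤ N →
    0 ≤ c + ∑ d : Fin (k + 1), (Φ k).coeff d * ∑ i, x i ⟨d, by omega⟩
  hankel : ∀ i, (hankelH (x i) (u i.castSucc) (u i.succ)).PosSemidef
  additional : ∀ L ∈ Ad, L.Holds c x

/-- The optimal value `c*(m)`: the supremum, in the extended reals, of all `c` that are attained
at feasible points (`+∞` if the program is unbounded). -/
noncomputable def optimalValue (N : ℕ∞) (Φ : ℕ → ℝ[X]) {ℓ : ℕ} (u : Fin (ℓ + 1) → ℝ)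
    (m : ℕ) (hm : 0 < m) (Ad : Set (PsdConstraint ℓ m)) : EReal :=
  sSup {v : EReal | ∃ (c : ℝ) (x : Fin ℓ → Fin (2 * m) → ℝ),
    IsFeasible N Φ u m hm Ad c x ∧ v = (c : EReal)}

end CodeBound

/-! Every nonempty `S`-code `C` yields the feasible point `c = |C|`, `x i d = powerSum F u C i d`,
so `|C|` is at most the optimal value. Here `z = |C|²`, which makes the matrix in `gamma` rank one,
and the Hankel blocks are moment matrices of finite measures. The analytic input is the Delsarte
inequality `IsZonalSpherical.sum_nonneg`. The integral operator with kernel `K(x, y) = φ(τ(x, y))`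
maps `W` to itself and commutes with `G`, so it is a scalar `r` by Schur's lemma. Applied to the
sections of `K`, this gives `∫ K(x, w) K(y, w) dμ(w) = r K(y, x)` with `r > 0`. Hence `r ∑∑ K(x, y)`
is the integral of a square. -/

namespace CodeBound

/-! ### Positive definiteness of zonal spherical functions. -/

section Zonal

variable {G M : Type*} [MetricSpace M] [Group G] [MulAction G M]

theorem IsTwoPointHomogeneous.isIsometricSMul (hM : IsTwoPointHomogeneous G M) :
    IsIsometricSMul G M :=
  ⟨fun g => Isometry.of_dist_eq (hM.dist_smul g)⟩

theorem IsTwoPointHomogeneous.isPretransitive (hM : IsTwoPointHomogeneous G M) :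
    MulAction.IsPretransitive G M :=
  ⟨fun x y => by
    obtain ⟨g, hg, -⟩ := hM.exists_smul x x y y (by simp)
    exact ⟨g, hg⟩⟩

/-- By transitivity and compactness, finitely many translates of a nonempty open set cover `M`, so
its measure cannot vanish. -/
theorem IsTwoPointHomogeneous.isOpenPosMeasure [CompactSpace M] [MeasurableSpace M]
    [BorelSpace M] (hM : IsTwoPointHomogeneous G M) (μ : Measure M) [IsProbabilityMeasure μ]
    [SMulInvariantMeasure G M μ] : μ.IsOpenPosMeasure := by
  have := hM.isIsometricSMul
  have := hM.isPretransitive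
  exact ⟨fun U hU hne => (measure_isOpen_pos_of_smulInvariant_of_compact_ne_zero G
    isCompact_univ (by simp) hU hne).ne'⟩

theorem tau_comm (F : ℝ → ℝ) (x y : M) : tau F x y = tau F y x := by
  simp [tau, dist_comm]

theorem IsTwoPointHomogeneous.tau_smul (hM : IsTwoPointHomogeneous G M) (F : ℝ → ℝ) (g : G)
    (x y : M) : tau F (g • x) (g • y) = tau F x y := by
  simp [tau, hM.dist_smul]

/-- A separating family of functionals on a finite-dimensional space spans the dual space. -/
theorem span_range_dual_eq_top {X K E : Type*} [Field K] [AddCommGroup E] [Module K E]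
    [FiniteDimensional K E] (e : X → Module.Dual K E) (he : ∀ f, (∀ x, e x f = 0) → f = 0) :
    Submodule.span K (Set.range e) = ⊤ := by
  refine Submodule.span_eq_top_of_ne_zero fun f hf => ?_
  by_contra! h
  exact hf (he f fun x => h _ ⟨x, rfl⟩)

/-- A symmetric kernel with sections in a finite-dimensional function space `W` turns every
linear functional on `W` into an element of `W`. -/
theorem exists_mem_eq_dual_apply {X : Type*} [TopologicalSpace X] (W : Submodule ℂ C(X, ℂ))
    [FiniteDimensional ℂ W] (Z : X → W) (hZ : ∀ x y, (Z x).1 y = (Z y).1 x)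
    (l : Module.Dual ℂ W) : ∃ f : W, ∀ x, f.1 x = l (Z x) := by
  let e : X → Module.Dual ℂ W := fun x =>
    { toFun := fun f => f.1 x
      map_add' := fun _ _ => rfl
      map_smul' := fun _ _ => rfl }
  -- Point evaluations span the dual, and evaluation at `y` is represented by `Z y` thanks to the
  -- symmetry of the kernel.
  have hl : l ∈ Submodule.span ℂ (Set.range e) :=
    (span_range_dual_eq_top (K := ℂ) (E := W) e
      fun f hf => Subtype.ext (ContinuousMap.ext hf)).ge Submodule.mem_top
  induction hl using Submodule.span_induction with
  | mem l hl =>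
    obtain ⟨y, rfl⟩ := hl
    exact ⟨Z y, fun x => hZ y x⟩
  | zero => exact ⟨0, fun x => rfl⟩
  | add l₁ l₂ _ _ h₁ h₂ =>
    obtain ⟨f₁, h₁⟩ := h₁
    obtain ⟨f₂, h₂⟩ := h₂
    exact ⟨f₁ + f₂, fun x => by simp [h₁, h₂]⟩
  | smul c l _ h =>
    obtain ⟨f, h⟩ := h
    exact ⟨c • f, fun x => by simp [h]⟩

theorem integrable_mul_continuousMap [CompactSpace M] [MeasurableSpace M]
    [BorelSpace M] (μ : Measure M) [IsFiniteMeasure μ] (f h : C(M, ℂ)) :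
    Integrable (fun y => f y * h y) μ :=
  (f * h).continuous.integrable_of_hasCompactSupport (HasCompactSupport.of_compactSpace _)

/-- Schur's lemma for the integral operator of an invariant symmetric kernel whose sections lie
in an irreducible representation: it acts as a scalar. -/
theorem IsIrreducible.exists_integral_eq_mul [CompactSpace M] [MeasurableSpace M]
    [BorelSpace M] [ContinuousConstSMul G M] (μ : Measure M) [IsFiniteMeasure μ]
    [SMulInvariantMeasure G M μ]
    {W : Submodule ℂ C(M, ℂ)} [FiniteDimensional ℂ W] (hW : IsIrreducible G W)
    (Z : M → W) (hZ : ∀ x y, (Z x).1 y = (Z y).1 x)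
    (hinv : ∀ (g : G) x y, (Z (g • x)).1 (g • y) = (Z x).1 y) :
    ∃ c : ℂ, ∀ f ∈ W, ∀ x, ∫ y, (Z x).1 y * f y ∂μ = c * f x := by
  have hint (f h : C(M, ℂ)) := integrable_mul_continuousMap μ f h
  let I (f : W) : Module.Dual ℂ W :=
    { toFun := fun h => ∫ y, h.1 y * f.1 y ∂μ
      map_add' := fun h₁ h₂ => by
        rw [← integral_add (hint _ _) (hint _ _)]
        simp [add_mul]
      map_smul' := fun c h => by
        simp [mul_assoc, integral_const_mul] }
  -- This is where `x ↦ ∫ Z x * f` is seen to lie in `W` again.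
  choose t ht using fun f => exists_mem_eq_dual_apply W Z hZ (I f)
  let T : Module.End ℂ W :=
    { toFun := t
      map_add' := fun f₁ f₂ => by
        ext x
        change (t _).1 x = (t _).1 x + (t _).1 x
        simp only [ht]
        change ∫ y, _ ∂μ = ∫ y, _ ∂μ + ∫ y, _ ∂μ
        rw [← integral_add (hint _ _) (hint _ _)]
        simp [mul_add]
      map_smul' := fun c f => by
        ext x
        change (t _).1 x = c * (t _).1 x
        simp only [ht]
        change ∫ y, _ ∂μ = c * ∫ y, _ ∂μ
        rw [← integral_const_mul]
        simp [mul_left_comm] }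
  have hT (f : W) (x : M) : (T f).1 x = ∫ y, (Z x).1 y * f.1 y ∂μ := ht f x
  have : Nontrivial W := Submodule.nontrivial_iff_ne_bot.2 hW.2.1
  obtain ⟨c, hc⟩ := Module.End.exists_eigenvalue T
  refine ⟨c, ?_⟩
  -- A nonzero invariant eigenspace must be all of `W`.
  let U : Submodule ℂ C(M, ℂ) := (Module.End.eigenspace T c).map W.subtype
  have hU (f : C(M, ℂ)) : f ∈ U ↔ f ∈ W ∧ ∀ x, ∫ y, (Z x).1 y * f y ∂μ = c * f x := by
    constructor
    · rintro ⟨f, hf, rfl⟩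
      refine ⟨f.2, fun x => ?_⟩
      have := Module.End.mem_eigenspace_iff.1 hf
      exact (hT f x).symm.trans (by rw [this]; rfl)
    · rintro ⟨hf, h⟩
      refine ⟨⟨f, hf⟩, Module.End.mem_eigenspace_iff.2 ?_, rfl⟩
      ext x
      exact (hT ⟨f, hf⟩ x).trans (h x)
  have hUW : U = W := by
    refine (hW.2.2 U (fun f hf => ((hU f).1 hf).1) ?_).resolve_left ?_
    · intro g f hf
      obtain ⟨hfW, hf⟩ := (hU f).1 hf
      obtain ⟨f', hf'W, hf'⟩ := hW.1 g f hfW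
      refine ⟨f', (hU f').2 ⟨hf'W, fun x => ?_⟩, hf'⟩
      -- Substituting `y ↦ g • y` and using invariance of the kernel shows that the operator
      -- commutes with translation.
      rw [hf', ← hf, ← integral_smul_eq_self (μ := μ) (g := g)
        (fun y => (Z (g • x)).1 y * f y)]
      simp only [hinv, hf']
    · intro h
      obtain ⟨f, hf, hf0⟩ := hc.exists_hasEigenvector
      apply hf0
      have : W.subtype f ∈ U := ⟨f, hf, rfl⟩
      rw [h] at this
      exact Subtype.ext this
  exact fun f hf => ((hU f).1 (hUW ▸ hf)).2

/-- Zonal spherical functions are positive definite. -/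
theorem IsZonalSpherical.sum_nonneg [CompactSpace M] [MeasurableSpace M]
    [BorelSpace M] (hM : IsTwoPointHomogeneous G M) (μ : Measure M) [IsProbabilityMeasure μ]
    [SMulInvariantMeasure G M μ] {F : ℝ → ℝ} {W : Submodule ℂ C(M, ℂ)} [FiniteDimensional ℂ W]
    (hW : IsIrreducible G W) {φ : ℝ[X]} (hφ : IsZonalSpherical F W φ) (C : Finset M) :
    0 ≤ ∑ x ∈ C, ∑ y ∈ C, φ.eval (tau F x y) := by
  rcases C.eq_empty_or_nonempty with rfl | ⟨x₀, -⟩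
  · simp
  have := hM.isIsometricSMul
  have := hM.isOpenPosMeasure μ
  set K : M → M → ℝ := fun x y => φ.eval (tau F x y) with hK
  choose z hzW hz using hφ.mem
  obtain ⟨c, hc⟩ := hW.exists_integral_eq_mul μ (fun x => ⟨z x, hzW x⟩)
    (fun x y => by simp [hz, tau_comm F x y]) (fun g x y => by simp [hz, hM.tau_smul])
  have hcont (x : M) : Continuous (K x) := by
    have : K x = fun y => (z x y).re := by ext y; simp [hz, hK]
    rw [this]
    exact Complex.continuous_re.comp (z x).continuous
  have hcR (x y : M) : ((∫ w, K x w * K y w ∂μ : ℝ) : ℂ) = c * (K y x : ℝ) := by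
    have := hc (z y) (hzW y) x
    simp only [hz] at this
    rw [← this, ← integral_complex_ofReal]
    simp [hK]
  have hK1 : K x₀ x₀ = 1 := hφ.normalized x₀
  set r : ℝ := ∫ w, K x₀ w * K x₀ w ∂μ with hr
  -- Evaluating at `x₀`, where `K = 1`, shows that the Schur scalar is real.
  have hcr : c = r := by
    have := hcR x₀ x₀
    rw [hK1] at this
    simpa using this.symm
  have hKK (x y : M) : ∫ w, K x w * K y w ∂μ = r * K y x := by
    have := hcR x y
    rw [hcr] at this
    exact_mod_cast this
  have hrpos : 0 < r :=
    ((hcont x₀).mul (hcont x₀)).integral_pos_of_hasCompactSupport_nonneg_nonzero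
      (HasCompactSupport.of_compactSpace _) (fun w => mul_self_nonneg _) (x := x₀)
      (by simp [hK1])
  have hint (x y : M) : Integrable (fun w => K x w * K y w) μ :=
    ((hcont x).mul (hcont y)).integrable_of_hasCompactSupport (HasCompactSupport.of_compactSpace _)
  have key : r * ∑ x ∈ C, ∑ y ∈ C, K x y = ∫ w, (∑ x ∈ C, K x w) * (∑ y ∈ C, K y w) ∂μ := by
    simp_rw [Finset.sum_mul_sum]
    rw [integral_finsetSum _ fun x _ => integrable_finsetSum _ fun y _ => hint x y,
      Finset.sum_comm, Finset.mul_sum]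
    refine Finset.sum_congr rfl fun x _ => ?_
    rw [integral_finsetSum _ fun y _ => hint x y, Finset.mul_sum]
    exact Finset.sum_congr rfl fun y _ => (hKK x y).symm
  refine nonneg_of_mul_nonneg_right ?_ hrpos
  rw [key]
  exact integral_nonneg fun w => mul_self_nonneg _

end Zonal

/-! ### Moment matrices. -/

section Hankel

theorem posSemidef_fromBlocks_diagonal {p q : Type*} [Fintype p] [Fintype q]
    {A : Matrix p p ℝ} {D : Matrix q q ℝ} (hA : A.PosSemidef) (hD : D.PosSemidef) :
    (Matrix.fromBlocks A 0 0 D).PosSemidef := by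
  refine .of_dotProduct_mulVec_nonneg ?_ fun v => ?_
  · exact Matrix.IsHermitian.fromBlocks hA.1 (by simp) hD.1
  · have h₁ := hA.dotProduct_mulVec_nonneg (v ∘ Sum.inl)
    have h₂ := hD.dotProduct_mulVec_nonneg (v ∘ Sum.inr)
    rw [Matrix.fromBlocks_mulVec]
    simp only [dotProduct, Fintype.sum_sum_type, Matrix.zero_mulVec, add_zero, zero_add,
      Sum.elim_inl, Sum.elim_inr] at h₁ h₂ ⊢
    exact add_nonneg h₁ h₂

/-- A Hankel matrix of moments of a discrete measure is positive semidefinite. -/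
theorem posSemidef_moments {ι : Type*} (P : Finset ι) (w t : ι → ℝ) (hw : ∀ p ∈ P, 0 ≤ w p)
    (m : ℕ) :
    (Matrix.of fun i j : Fin m => ∑ p ∈ P, w p * t p ^ ((i : ℕ) + j)).PosSemidef := by
  have : (Matrix.of fun i j : Fin m => ∑ p ∈ P, w p * t p ^ ((i : ℕ) + j)) =
      ∑ p ∈ P, w p • Matrix.vecMulVec (fun i : Fin m => t p ^ (i : ℕ))
        (star fun i : Fin m => t p ^ (i : ℕ)) := by
    ext i j
    simp [Matrix.sum_apply, Matrix.vecMulVec_apply, pow_add]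
  rw [this]
  exact Matrix.posSemidef_sum _ fun p hp =>
    (Matrix.posSemidef_vecMulVec_self_star _).smul (hw p hp)

/-- The blocks are moment matrices for the weights `1`, `t - α` and `β - t`, all nonnegative on `[α,
β]`. -/
theorem posSemidef_hankelH {ι : Type*} (P : Finset ι) (t : ι → ℝ) {α β : ℝ}
    (ht : ∀ p ∈ P, t p ∈ Set.Icc α β) (m : ℕ) :
    (hankelH (fun d : Fin (2 * m) => ∑ p ∈ P, t p ^ (d : ℕ)) α β).PosSemidef := by
  refine posSemidef_fromBlocks_diagonal ?_ (posSemidef_fromBlocks_diagonal ?_ ?_)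
  · convert posSemidef_moments P (fun _ => 1) t (fun _ _ => zero_le_one) m using 1
    ext i j
    simp [hankelR]
  · convert posSemidef_moments P (fun p => t p - α) t
      (fun p hp => sub_nonneg.2 (ht p hp).1) m using 1
    ext i j
    simp only [hankelPlus, Matrix.of_apply, Finset.mul_sum, ← Finset.sum_sub_distrib]
    exact Finset.sum_congr rfl fun p _ => by ring
  · convert posSemidef_moments P (fun p => β - t p) t
      (fun p hp => sub_nonneg.2 (ht p hp).2) m using 1
    ext i j
    simp only [hankelMinus, Matrix.of_apply, Finset.mul_sum, ← Finset.sum_sub_distrib]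
    exact Finset.sum_congr rfl fun p _ => by ring

end Hankel

/-! ### The partition of the interval. -/

section Pieces

variable {ℓ : ℕ} {u : Fin (ℓ + 1) → ℝ}

theorem piece_subset_Icc (i : Fin ℓ) : piece u i ⊆ Set.Icc (u i.castSucc) (u i.succ) := by
  unfold piece
  split_ifs
  · exact subset_rfl
  · exact Set.Ico_subset_Icc_self

theorem lt_of_mem_piece {i : Fin ℓ} (hi : (i : ℕ) + 1 ≠ ℓ) {t : ℝ} (ht : t ∈ piece u i) :
    t < u i.succ := by
  rw [piece, if_neg hi] at ht
  exact ht.2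

theorem existsUnique_mem_piece (hℓ : 0 < ℓ) (hu : StrictMono u) {t : ℝ}
    (ht : t ∈ Set.Icc (u 0) (u (Fin.last ℓ))) : ∃! i, t ∈ piece u i := by
  classical
  have hne : (Finset.univ.filter fun i : Fin ℓ => u i.castSucc ≤ t).Nonempty :=
    ⟨⟨0, hℓ⟩, by simpa using ht.1⟩
  -- The piece containing `t` has the largest index whose left endpoint is at most `t`; closedness
  -- of the last piece covers `t = u ℓ`.
  obtain ⟨i, hi, hmax⟩ := Finset.exists_max_image _ id hne
  simp only [Finset.mem_filter, Finset.mem_univ, true_and, id] at hi hmax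
  refine ⟨i, ?_, fun j hj => ?_⟩
  · beta_reduce
    unfold piece
    split_ifs with h
    · refine ⟨hi, ?_⟩
      have : i.succ = Fin.last ℓ := Fin.ext (by simpa using h)
      rw [this]
      exact ht.2
    · refine ⟨hi, lt_of_not_ge fun hlt => ?_⟩
      have := hmax ⟨i + 1, by omega⟩ hlt
      simp [Fin.le_def] at this
  · refine le_antisymm (hmax j (piece_subset_Icc j hj).1) (le_of_not_gt fun hlt => ?_)
    have hlt' : (j : ℕ) < i := hlt
    -- Since `j < i`, piece `j` is not the last one, hence open on the right.
    have h₁ := lt_of_mem_piece (by omega) hj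
    have h₂ : u j.succ ≤ u i.castSucc := hu.monotone (by
      rw [Fin.le_def]
      simpa using hlt')
    linarith

end Pieces

/-! ### Power sums of a code, summed over the partition. -/

section Feasible

variable {M : Type*} [MetricSpace M] {F : ℝ → ℝ} {ℓ : ℕ} {u : Fin (ℓ + 1) → ℝ} {C : Finset M}

open Classical in
theorem sum_powerSum (hℓ : 0 < ℓ) (hu : StrictMono u)
    (hC : IsCode F (Set.Icc (u 0) (u (Fin.last ℓ))) C) (d : ℕ) :
    ∑ i, powerSum F u C i d = ∑ p ∈ C.offDiag, tau F p.1 p.2 ^ d := by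
  simp only [powerSum, Finset.sum_filter]
  rw [Finset.sum_comm]
  refine Finset.sum_congr rfl fun p hp => ?_
  rw [Finset.mem_offDiag] at hp
  obtain ⟨i, hi, huniq⟩ := existsUnique_mem_piece hℓ hu (hC _ hp.1 _ hp.2.1 hp.2.2)
  rw [Finset.sum_eq_single i, if_pos hi]
  · exact fun j _ hj => if_neg fun h => hj (huniq j h)
  · simp

theorem sum_powerSum_zero (hℓ : 0 < ℓ) (hu : StrictMono u)
    (hC : IsCode F (Set.Icc (u 0) (u (Fin.last ℓ))) C) :
    (C.card : ℝ) + ∑ i, powerSum F u C i 0 = (C.card : ℝ) * C.card := by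
  classical
  rw [sum_powerSum hℓ hu hC]
  simp [Finset.offDiag_card, Nat.cast_sub (Nat.le_mul_self C.card)]

-- The diagonal pairs contribute `|C|` because `φ` is normalized; the remaining pairs give the power
-- sums.
open Classical in
theorem card_add_sum_coeff_mul_powerSum (hℓ : 0 < ℓ) (hu : StrictMono u)
    (hC : IsCode F (Set.Icc (u 0) (u (Fin.last ℓ))) C) {φ : ℝ[X]} {k : ℕ}
    (hφ : ∀ x : M, φ.eval (tau F x x) = 1) (hk : φ.natDegree ≤ k) :
    (C.card : ℝ) + ∑ d : Fin (k + 1), φ.coeff d * ∑ i, powerSum F u C i d =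
      ∑ x ∈ C, ∑ y ∈ C, φ.eval (tau F x y) := by
  simp only [sum_powerSum hℓ hu hC, Finset.mul_sum]
  rw [Finset.sum_comm, ← Finset.sum_product' C C, ← Finset.diag_union_offDiag,
    Finset.sum_union (Finset.disjoint_diag_offDiag _)]
  congr 1
  · rw [Finset.sum_diag]
    simp [hφ]
  · refine Finset.sum_congr rfl fun p _ => ?_
    rw [Polynomial.eval_eq_sum_range' (Nat.lt_succ_of_le hk), Finset.sum_range]

end Feasible

end CodeBound

/-! ### Feasibility of codes and passage to the supremum. -/

theorem theorem6p1 {M G : Type*} [MetricSpace M] [CompactSpace M] [Nonempty M]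
    [MeasurableSpace M] [BorelSpace M] [Group G] [MulAction G M]
    (hM : CodeBound.IsTwoPointHomogeneous G M)
    -- the normalized invariant measure on `M`
    (μ : Measure M) [IsProbabilityMeasure μ] [SMulInvariantMeasure G M μ]
    -- `τ = F ∘ ρ` and the zonal spherical functions, which are polynomials of degree `k` in `τ`
    (F : ℝ → ℝ) (N : ℕ∞) (V : ℕ → Submodule ℂ C(M, ℂ))
    (hV : CodeBound.IsHarmonicDecomposition G μ N V)
    (Φ : ℕ → ℝ[X])
    (hΦ : ∀ k : ℕ, (k : ℕ∞) ≤ N → CodeBound.IsZonalSpherical F (V k) (Φ k))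
    (hdeg : ∀ k : ℕ, (k : ℕ∞) ≤ N → (Φ k).natDegree = k)
    -- `S = T ∩ [a, b]`, with `[a, b]` cut into `ℓ ≥ 1` subintervals
    (a b : ℝ) (ℓ : ℕ) (hℓ : 0 < ℓ) (u : Fin (ℓ + 1) → ℝ) (hu : StrictMono u)
    (hua : u 0 = a) (hub : u (Fin.last ℓ) = b)
    (S : Set ℝ) (hS : S = CodeBound.tauRange M F ∩ Set.Icc a b)
    (m : ℕ) (hm : 0 < m)
    -- the additional constraints, each of them a valid constraint for `S`-codes
    (Ad : Set (CodeBound.PsdConstraint ℓ m))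
    (hAd : ∀ C : Finset M, C.Nonempty → CodeBound.IsCode F S C →
      ∀ L ∈ Ad, L.Holds (C.card : ℝ) (fun i d => CodeBound.powerSum F u C i d)) :
    (((CodeBound.maxCodeSize M F S : ℕ∞) : ℝ≥0∞) : EReal) ≤
      CodeBound.optimalValue N Φ u m hm Ad := by
  have hfeas (C : Finset M) (hne : C.Nonempty) (hC : CodeBound.IsCode F S C) :
      CodeBound.IsFeasible N Φ u m hm Ad C.card (fun i d => CodeBound.powerSum F u C i d) := by
    have hC' : CodeBound.IsCode F (Set.Icc (u 0) (u (Fin.last ℓ))) C := fun x hx y hy hxy => by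
      have := hC x hx y hy hxy
      rw [hS, ← hua, ← hub] at this
      exact this.2
    refine ⟨?_, fun k _ _ hkN => ?_, fun i => ?_, hAd C hne hC⟩
    · rw [CodeBound.sum_powerSum_zero hℓ hu hC']
      -- With `z = |C|²` the matrix is `v vᵀ` for `v = (1, |C|)`.
      convert Matrix.posSemidef_vecMulVec_self_star ![1, (C.card : ℝ)] using 1
      ext i j
      fin_cases i <;> fin_cases j <;> simp [Matrix.vecMulVec_apply]
    · have := hV.finiteDimensional k hkN
      rw [CodeBound.card_add_sum_coeff_mul_powerSum hℓ hu hC' (hΦ k hkN).normalized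
        (hdeg k hkN).le]
      exact (hΦ k hkN).sum_nonneg hM μ (hV.irreducible k hkN) C
    · classical
      exact CodeBound.posSemidef_hankelH _ _ (fun p hp =>
        CodeBound.piece_subset_Icc i (Finset.mem_filter.1 hp).2) m
  have hle (C : Finset M) (hne : C.Nonempty) (hC : CodeBound.IsCode F S C) :
      ((C.card : ℝ) : EReal) ≤ CodeBound.optimalValue N Φ u m hm Ad :=
    le_sSup ⟨_, _, hfeas C hne hC, rfl⟩
  have hcast (n : ℕ) : (((n : ℕ∞) : ℝ≥0∞) : EReal) = ((n : ℝ) : EReal) := by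
    rw [ENat.toENNReal_coe, ← ENNReal.ofReal_natCast, EReal.coe_ennreal_ofReal,
      max_eq_left n.cast_nonneg]
  have hle' (C : Finset M) (hC : CodeBound.IsCode F S C) :
      (((C.card : ℕ∞) : ℝ≥0∞) : EReal) ≤ CodeBound.optimalValue N Φ u m hm Ad := by
    rw [hcast]
    rcases C.eq_empty_or_nonempty with rfl | hne
    -- The empty code need not satisfy `Ad`, so it is compared with a singleton, which is vacuously
    -- a code.
    · obtain ⟨x⟩ := ‹Nonempty M›
      refine le_trans ?_ (hle {x} (Finset.singleton_nonempty x) (by simp [CodeBound.IsCode]))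
      simp
    · exact hle C hne hC
  -- Nonnegativity allows the comparison to be made in `ℝ≥0∞`, where the cast from `ℕ∞` commutes
  -- with suprema.
  have h0 : 0 ≤ CodeBound.optimalValue N Φ u m hm Ad := by
    simpa using hle' ∅ (by simp [CodeBound.IsCode])
  rw [← EReal.coe_toENNReal h0, EReal.coe_ennreal_le_coe_ennreal_iff, CodeBound.maxCodeSize]
  simp only [ENat.toENNReal_iSup]
  refine iSup₂_le fun C hC => ?_
  rw [← EReal.coe_ennreal_le_coe_ennreal_iff, EReal.coe_toENNReal h0]
  exact hle' C hC
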